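/- **Task and execution.** A periodic task has period $T>0$, relative deadline $D>0$ (no relation between $D$ and $T$ is assumed) and relative dismiss point $0\le\delta<\infty$. Its $j$-th job ($j=1,2,\dots$) is released at $(j-1)T$, has absolute deadline $(j-1)T+D$ and absolute dismiss point $(j-1)T+D+\delta$. The execution times $C_1,C_2,\dots$ are i.i.d. with finitely many values $0<e_1<\dots<e_h$, $\mathbb P(C_j=e_k)=p_k$, $\sum_k p_k=1$. The service available in $[(j-1)T,(j-1)T+t)$, $0\le t\le T$, is $\beta_j(t)$, where $\beta_j(0)=0$, $\beta_j$ is nondecreasing and $\beta_j(t+\varepsilon)\le\beta_j(t)+\varepsilon$ for $\varepsilon>0$, $t+\varepsilon\le T$. Jobs are processed greedily in first-come-first-serve order; a job leaves when it has received its execution time or when its absolute dismiss point is reached. It misses its deadline if it is not completed by its absolute deadline; $\mathrm{DMR}_N$ is the fraction of the first $N$ jobs that miss their deadlines. If $\mathrm{DMR}_N$ converges almost surely to a constant $\mathrm{DMR}$, this constant is the deadline miss rate of the task. **Supply bounds.** Only curves $\beta^l_j,\beta^u_j$, repeating after $Q\ge1$ periods, are given; the actual (possibly random) service satisfies $\beta^l_j(t)\le\beta_j(t)\le\beta^u_j(t)$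 for all $j$ and $0\le t\le T$. For $x\in\{l,u\}$ put $$service^x(j,t)=\sum_{\ell=j}^{j+\lfloor t/T\rfloor-1}\beta^x_\ell(T)+\beta^x_{j+\lfloor t/T\rfloor}\bigl(t-T\lfloor t/T\rfloor\bigr).$$ **Markov chain.** A state consists of a job index modulo $Q$, a hit/miss indicator, and a remaining execution time $rem\ge0$. Given a state $s$ of job $j$ and an execution time $e_k$ of job $j+1$, let $w=e_k+rem(s)$. The next state belongs to job index $j+1$ modulo $Q$. If $w\le service^l(j+1,D)$, it is a hit with remaining execution time $\max\{w-\beta^l_{j+1}(T),0\}$. Otherwise it is a miss with remaining execution time $\max\{\min\{w,service^u(j+1,D+\delta)\}-\beta^l_{j+1}(T),0\}$. The states of job $1$ are obtained in the same way with $w=e_k$. Let $S$ be the set of all states generated from these initial states, $P_{r,s}$ the sum of the $p_k$ over those $k$ for which $e_k$ leads from $s$ to $r$, and $S_{DM}\subseteq S$ the set of miss states. **Theorem.** Suppose that $S$ is finite and that the chain is irreducible (any two states are reachable from one another through transitions of positive probability). Then there is a unique probability distribution $\pi$ on $S$ with $P\pi=\pi$, and for every service that respects the bounds, the deadline miss rate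 of the task is at most $\sum_{s\in S_{DM}}\pi_s$: almost surely $$\limsup_{N\to\infty}\mathrm{DMR}_N\le\sum_{s\in S_{DM}}\pi_s,$$ and in particular $\mathrm{DMR}\le\sum_{s\in S_{DM}}\pi_s$ whenever the deadline miss rate $\mathrm{DMR}$ exists. -/

import Mathlib

open MeasureTheory ProbabilityTheory Filter Topology

noncomputable section

/-- A periodic soft real-time task with period `T`, relative deadline `D`, relative dismiss
point `δ` (after the deadline), and an execution time that takes `h` distinct values
`e 0 < e 1 < ⋯` with probabilities `p 0, p 1, …`. -/
structure PeriodicTask where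
  T : ℝ
  D : ℝ
  δ : ℝ
  h : ℕ
  e : Fin h → ℝ
  p : Fin h → ℝ
  T_pos : 0 < T
  D_pos : 0 < D
  δ_nonneg : 0 ≤ δ
  e_pos : ∀ k, 0 < e k
  e_strictMono : StrictMono e
  p_nonneg : ∀ k, 0 ≤ p k
  p_sum : ∑ k, p k = 1

/-- `b t` is a possible amount of service provided during the first `t` time units of a period
of length `T`: it starts at `0`, is nondecreasing, and grows at rate at most `1`. -/
structure IsSupply (T : ℝ) (b : ℝ → ℝ) : Prop where
  zero : b 0 = 0
  mono : MonotoneOn b (Set.Icc 0 T)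
  rate : ∀ t ε : ℝ, 0 ≤ t → 0 < ε → t + ε ≤ T → b (t + ε) ≤ b t + ε

/-- The accumulated service in `[j T, j T + t)`, where `b i` describes the service within the
`i`-th period `[i T, (i + 1) T)`. Periods and jobs are numbered from `0`. -/
def service (T : ℝ) (b : ℕ → ℝ → ℝ) (j : ℕ) (t : ℝ) : ℝ :=
  (∑ i ∈ Finset.range ⌊t / T⌋₊, b (j + i) T) + b (j + ⌊t / T⌋₊) (t - T * ⌊t / T⌋₊)

/-- Upper and lower supply bound curves for every period, repeating after `Q` periods. -/
structure SupplyBounds (T : ℝ) where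
  Q : ℕ
  upper : ℕ → ℝ → ℝ
  lower : ℕ → ℝ → ℝ
  Q_pos : 0 < Q
  upper_periodic : ∀ j, ∀ t ∈ Set.Icc 0 T, upper (j + Q) t = upper j t
  lower_periodic : ∀ j, ∀ t ∈ Set.Icc 0 T, lower (j + Q) t = lower j t

/-- The actual service `b` lies between the bound curves. -/
def SupplyBounds.Bounds {T : ℝ} (sb : SupplyBounds T) (b : ℕ → ℝ → ℝ) : Prop :=
  ∀ j, ∀ t ∈ Set.Icc 0 T, sb.lower j t ≤ b j t ∧ b j t ≤ sb.upper j t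

/-! ### The actual execution: greedy first-come-first-serve processing with dismissal -/

namespace PeriodicTask

variable (τ : PeriodicTask)

/-- `τ.freeAt b c j` is the time at which all jobs before job `j` have left the system, for
service `b` and execution times `c`. Job `j`, released at `j T`, is served from
`max (j T) (τ.freeAt b c j)` on, and leaves as soon as it has received `c j` units of service or
its dismiss point `j T + D + δ` is reached. -/
def freeAt (b : ℕ → ℝ → ℝ) (c : ℕ → ℝ) : ℕ → ℝ
  | 0 => 0
  | j + 1 =>
    let start := max (j * τ.T) (freeAt b c j)
    sInf {t : ℝ | start ≤ t ∧
      (c j ≤ service τ.T b 0 t - service τ.T b 0 start ∨ j * τ.T + τ.D + τ.δ ≤ t)}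

/-- The time from which on job `j` is the job being served. -/
def startTime (b : ℕ → ℝ → ℝ) (c : ℕ → ℝ) (j : ℕ) : ℝ :=
  max (j * τ.T) (τ.freeAt b c j)

/-- Job `j` does not receive its full execution time by its absolute deadline `j T + D`. -/
def MissesDeadline (b : ℕ → ℝ → ℝ) (c : ℕ → ℝ) (j : ℕ) : Prop :=
  ¬ ∃ t : ℝ, τ.startTime b c j ≤ t ∧ t ≤ j * τ.T + τ.D ∧
    c j ≤ service τ.T b 0 t - service τ.T b 0 (τ.startTime b c j)

open Classical in
/-- The deadline miss rate of the first `N` jobs. -/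
def missRate (b : ℕ → ℝ → ℝ) (c : ℕ → ℝ) (N : ℕ) : ℝ :=
  (1 / (N : ℝ)) * ∑ j ∈ Finset.range N, if τ.MissesDeadline b c j then 1 else 0

/-- The execution times `C j` of the jobs are independent copies of the execution time
of the task. -/
structure IsExecutionTime {Ω : Type*} [MeasurableSpace Ω] (μ : Measure Ω)
    (C : ℕ → Ω → ℝ) : Prop where
  measurable : ∀ j, Measurable (C j)
  indep : iIndepFun C μ
  law : ∀ j k, μ.real {ω | C j ω = τ.e k} = τ.p k

end PeriodicTask

/-! ### The Markov chain constructed from the supply bounds -/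

/-- A state: the number of the job modulo `Q`, whether the job is classified as a deadline
miss, and the remaining execution time at the end of its period. -/
@[ext]
structure ChainState where
  slot : ℕ
  miss : Bool
  rem : ℝ

namespace PeriodicTask

variable (τ : PeriodicTask) (sb : SupplyBounds τ.T)

open Classical in
/-- The state of a job in slot `q` whose execution time, together with the remaining execution
time of the preceding state, is `w`. -/
def jobState (q : ℕ) (w : ℝ) : ChainState where
  slot := q
  miss := decide (service τ.T sb.lower q τ.D < w)
  rem :=
    if w ≤ service τ.T sb.lower q τ.D then
      max (w - sb.lower q τ.T) 0
    else
      max (min w (service τ.T sb.upper q (τ.D + τ.δ)) - sb.lower q τ.T) 0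

/-- The successor of the state `s` when the next job has execution time `x`. -/
def nextState (s : ChainState) (x : ℝ) : ChainState :=
  τ.jobState sb ((s.slot + 1) % sb.Q) (x + s.rem)

/-- The states created by the state expansion. -/
inductive Reachable : ChainState → Prop
  | init (k : Fin τ.h) : Reachable (τ.jobState sb 0 (τ.e k))
  | step (s : ChainState) (k : Fin τ.h) : Reachable s → Reachable (τ.nextState sb s (τ.e k))

/-- The state space of the constructed Markov chain. -/
def ChainSpace : Type := {s : ChainState // τ.Reachable sb s}

open Classical in
/-- The (column-stochastic) transition matrix: `transition r s` is the probability of going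
from `s` to `r`. -/
def transition : Matrix (τ.ChainSpace sb) (τ.ChainSpace sb) ℝ := fun r s =>
  ∑ k, if τ.nextState sb s.1 (τ.e k) = r.1 then τ.p k else 0

/-- The states that indicate a deadline miss. -/
def missStates [Fintype (τ.ChainSpace sb)] : Finset (τ.ChainSpace sb) :=
  Finset.univ.filter fun s => s.1.miss = true

end PeriodicTask

/-- Every state can be reached from every state by transitions of positive probability. -/
def IsIrreducibleChain {S : Type*} (P : Matrix S S ℝ) : Prop :=
  ∀ r s : S, Relation.TransGen (fun a b => 0 < P b a) r s

/-- A probability distribution `π` with `P π = π`. -/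
structure IsStationaryDistribution {S : Type*} [Fintype S] (P : Matrix S S ℝ) (π : S → ℝ) : Prop where
  nonneg : ∀ s, 0 ≤ π s
  sum_eq_one : ∑ s, π s = 1
  invariant : P.mulVec π = π

end

/-! The argument has a deterministic and a probabilistic half. Fix one outcome and drive the chain
with the actual execution times. By induction over the jobs, the work actually carried into a period
is at most the remaining time stored in the chain (`backlog_le_carryIn`), so every real deadline
miss is a miss state (`statePath_miss_of_missesDeadline`). This comparison is pathwise; the service
may therefore depend on the outcome in any way.

It remains to bound the frequency of miss states. For an irreducible finite chain the Poisson
equation f = g - E[g(next)] + π(f) is solvable (`IsIrreducibleChain.exists_poisson`). Summed along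
the path, f becomes nπ(f) plus a bounded telescoping term plus a sum of conditionally centred
bounded increments. A Chernoff bound and Borel-Cantelli keep that last sum eventually below εn
(`ae_eventually_orbitSum_lt`). Only this upper half of the ergodic theorem is needed. -/

theorem MonotoneOn.of_grid {T : ℝ} (hT : 0 < T) {F : ℝ → ℝ}
    (hF : ∀ j : ℕ, MonotoneOn F (Set.Icc (j * T) ((j + 1) * T))) : MonotoneOn F (Set.Ici 0) := by
  have grid : Monotone fun j : ℕ => F (j * T) := monotone_nat_of_le_succ fun j => by
    have h : (j : ℝ) * T ≤ (j + 1) * T := by nlinarith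
    have := hF j ⟨le_rfl, h⟩ ⟨h, le_rfl⟩ h
    simpa using this
  have floor_mem : ∀ t : ℝ, 0 ≤ t → t ∈ Set.Icc (⌊t / T⌋₊ * T) ((⌊t / T⌋₊ + 1) * T) := fun t ht =>
    ⟨(le_div_iff₀ hT).1 (Nat.floor_le (by positivity)),
      ((div_lt_iff₀ hT).1 (Nat.lt_floor_add_one _)).le⟩
  intro s hs t ht hst
  have hs' := floor_mem s hs
  have ht' := floor_mem t ht
  rcases (Nat.floor_mono (div_le_div_of_nonneg_right hst hT.le)).eq_or_lt with h | h
  · rw [← h] at ht'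
    exact hF _ hs' ht' hst
  · have h1 := hF _ hs' ⟨hs'.1.trans hs'.2, le_rfl⟩ hs'.2
    have h2 := hF _ ⟨le_rfl, ht'.1.trans ht'.2⟩ ht' ht'.1
    have h3 : F (((⌊s / T⌋₊ : ℝ) + 1) * T) ≤ F (⌊t / T⌋₊ * T) := by
      simpa using grid (Nat.succ_le_of_lt h)
    exact h1.trans (h3.trans h2)

/-! ### Accumulated service over several periods -/

section Service

variable {T : ℝ} {b : ℕ → ℝ → ℝ}

theorem natFloor_add_mul_div (hT : 0 < T) (j : ℕ) {t : ℝ} (ht : 0 ≤ t) :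
    ⌊(j * T + t) / T⌋₊ = j + ⌊t / T⌋₊ := by
  rw [add_div, mul_div_cancel_right₀ _ hT.ne', add_comm, Nat.floor_add_natCast (by positivity),
    add_comm]

theorem sub_mul_natFloor_mem (hT : 0 < T) {t : ℝ} (ht : 0 ≤ t) :
    t - T * ⌊t / T⌋₊ ∈ Set.Icc 0 T := by
  have h1 := (le_div_iff₀ hT).1 (Nat.floor_le (div_nonneg ht hT.le))
  have h2 := (div_lt_iff₀ hT).1 (Nat.lt_floor_add_one (t / T))
  constructor <;> nlinarith

theorem service_mul_add (hT : 0 < T) (hb : ∀ j, IsSupply T (b j)) (j : ℕ) {t : ℝ} (ht : 0 ≤ t) :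
    service T b 0 (j * T + t) = service T b 0 (j * T) + service T b j t := by
  have h0 : service T b 0 (j * T) = ∑ i ∈ Finset.range j, b i T := by
    simp [service, mul_div_cancel_right₀ _ hT.ne', (hb _).zero, mul_comm T]
  rw [h0, service, natFloor_add_mul_div hT j ht, Finset.sum_range_add, service]
  have : (j : ℝ) * T + t - T * ((j + ⌊t / T⌋₊ : ℕ) : ℝ) = t - T * ⌊t / T⌋₊ := by
    push_cast; ring
  rw [this]
  simp [add_assoc]

theorem service_of_mem (hT : 0 < T) (hb : ∀ j, IsSupply T (b j)) (j : ℕ) {t : ℝ}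
    (ht : t ∈ Set.Icc 0 T) : service T b j t = b j t := by
  rcases ht.2.eq_or_lt with rfl | h
  · simp [service, div_self hT.ne', (hb _).zero]
  · have : ⌊t / T⌋₊ = 0 := Nat.floor_eq_zero.2 ((div_lt_one hT).2 h)
    simp [service, this]

theorem service_succ_mul (hT : 0 < T) (hb : ∀ j, IsSupply T (b j)) (j : ℕ) :
    service T b 0 ((j + 1) * T) = service T b 0 (j * T) + b j T := by
  rw [add_mul, one_mul, service_mul_add hT hb j hT.le, service_of_mem hT hb j ⟨hT.le, le_rfl⟩]

theorem service_eq_on_period (hT : 0 < T) (hb : ∀ j, IsSupply T (b j)) (j : ℕ) {t : ℝ}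
    (ht : t ∈ Set.Icc (j * T) ((j + 1) * T)) :
    t - j * T ∈ Set.Icc 0 T ∧
      service T b 0 t = service T b 0 (j * T) + b j (t - j * T) := by
  have h : t - j * T ∈ Set.Icc 0 T := ⟨by linarith [ht.1], by linarith [ht.2]⟩
  refine ⟨h, ?_⟩
  rw [← service_of_mem hT hb j h, ← service_mul_add hT hb j h.1]
  congr 1; ring

theorem service_monotoneOn (hT : 0 < T) (hb : ∀ j, IsSupply T (b j)) :
    MonotoneOn (service T b 0) (Set.Ici 0) :=
  MonotoneOn.of_grid hT fun j s hs t ht hst => by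
    obtain ⟨hs', es⟩ := service_eq_on_period hT hb j hs
    obtain ⟨ht', et⟩ := service_eq_on_period hT hb j ht
    rw [es, et]
    gcongr
    exact (hb j).mono hs' ht' (by linarith)

theorem service_le_add_sub (hT : 0 < T) (hb : ∀ j, IsSupply T (b j)) {s t : ℝ} (hs : 0 ≤ s)
    (hst : s ≤ t) : service T b 0 t ≤ service T b 0 s + (t - s) := by
  -- Rate at most 1 is rephrased as monotonicity, which glues across period boundaries.
  have : MonotoneOn (fun t => t - service T b 0 t) (Set.Ici 0) :=
    MonotoneOn.of_grid hT fun j s hs t ht hst => by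
      obtain ⟨hs', es⟩ := service_eq_on_period hT hb j hs
      obtain ⟨ht', et⟩ := service_eq_on_period hT hb j ht
      simp only [es, et]
      rcases hst.eq_or_lt with rfl | hlt
      · exact le_rfl
      · have := (hb j).rate (s - j * T) (t - s) hs'.1 (sub_pos.2 hlt) (by linarith [ht'.2])
        rw [show s - j * T + (t - s) = t - j * T by ring] at this
        linarith
  have := this hs (hs.trans hst) hst
  simp only at this
  linarith

theorem service_le_service (hT : 0 < T) {b₁ b₂ : ℕ → ℝ → ℝ}
    (h : ∀ j, ∀ t ∈ Set.Icc 0 T, b₁ j t ≤ b₂ j t) (j : ℕ) {t : ℝ} (ht : 0 ≤ t) :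
    service T b₁ j t ≤ service T b₂ j t :=
  add_le_add (Finset.sum_le_sum fun _ _ => h _ _ ⟨hT.le, le_rfl⟩)
    (h _ _ (sub_mul_natFloor_mem hT ht))

theorem apply_mod_eq {Q : ℕ} (hper : ∀ j, ∀ t ∈ Set.Icc 0 T, b (j + Q) t = b j t) (j i : ℕ)
    {t : ℝ} (ht : t ∈ Set.Icc 0 T) : b (j % Q + i) t = b (j + i) t := by
  have key : ∀ m n, b (n + Q * m) t = b n t := by
    intro m
    induction m with
    | zero => simp
    | succ m ih => intro n; rw [Nat.mul_succ, ← add_assoc, hper _ t ht, ih]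
  conv_rhs => rw [← Nat.mod_add_div j Q]
  rw [add_right_comm, key]

theorem service_mod (hT : 0 < T) {Q : ℕ} (hper : ∀ j, ∀ t ∈ Set.Icc 0 T, b (j + Q) t = b j t)
    (j : ℕ) {t : ℝ} (ht : 0 ≤ t) : service T b (j % Q) t = service T b j t := by
  unfold service
  rw [apply_mod_eq hper j _ (sub_mul_natFloor_mem hT ht)]
  congr 1
  exact Finset.sum_congr rfl fun i _ => apply_mod_eq hper j i ⟨hT.le, le_rfl⟩

end Service

namespace PeriodicTask

variable (τ : PeriodicTask)

/-! ### Work carried from one period to the next -/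

section Execution

variable {b : ℕ → ℝ → ℝ} {c : ℕ → ℝ}

/-- The previous job is gone by its own, earlier dismiss point. Hence the dismiss point of job `j`
lies in the set defining `freeAt`, and the infimum is taken over a nonempty set. -/
theorem freeAt_le (b : ℕ → ℝ → ℝ) (c : ℕ → ℝ) (j : ℕ) :
    0 ≤ τ.freeAt b c j ∧ τ.startTime b c j ≤ j * τ.T + τ.D + τ.δ ∧
      τ.startTime b c j ≤ τ.freeAt b c (j + 1) ∧
      τ.freeAt b c (j + 1) ≤ j * τ.T + τ.D + τ.δ := by
  have hT := τ.T_pos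
  have hD := τ.D_pos
  have hδ := τ.δ_nonneg
  have step : ∀ j, τ.startTime b c j ≤ j * τ.T + τ.D + τ.δ →
      τ.startTime b c j ≤ τ.freeAt b c (j + 1) ∧
      τ.freeAt b c (j + 1) ≤ j * τ.T + τ.D + τ.δ := fun j h =>
    ⟨le_csInf ⟨_, h, Or.inr le_rfl⟩ fun _ ht => ht.1,
      csInf_le ⟨τ.startTime b c j, fun t ht => ht.1⟩ ⟨h, Or.inr le_rfl⟩⟩
  induction j with
  | zero =>
    have h : τ.startTime b c 0 ≤ (0 : ℕ) * τ.T + τ.D + τ.δ := by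
      simp only [startTime, freeAt, Nat.cast_zero, zero_mul, max_self]
      linarith
    exact ⟨le_rfl, h, step 0 h⟩
  | succ j ih =>
    have h0 : 0 ≤ τ.freeAt b c (j + 1) :=
      (le_max_of_le_right ih.1 : (0 : ℝ) ≤ τ.startTime b c j).trans ih.2.2.1
    have h : τ.startTime b c (j + 1) ≤ (j + 1 : ℕ) * τ.T + τ.D + τ.δ := by
      refine max_le (by linarith) (ih.2.2.2.trans ?_)
      push_cast
      linarith
    exact ⟨h0, h, step _ h⟩

theorem startTime_nonneg (j : ℕ) : 0 ≤ τ.startTime b c j :=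
  le_max_of_le_right (τ.freeAt_le b c j).1

/-- Just before it leaves, a job has received less than `c j`; since service grows at rate at most
1, the infimum cannot overshoot. -/
theorem service_freeAt_succ_le (hb : ∀ j, IsSupply τ.T (b j)) (hc : ∀ j, 0 < c j) (j : ℕ) :
    service τ.T b 0 (τ.freeAt b c (j + 1)) ≤ service τ.T b 0 (τ.startTime b c j) + c j := by
  obtain ⟨-, -, hle, -⟩ := τ.freeAt_le b c j
  have hs := τ.startTime_nonneg (b := b) (c := c) j
  rcases hle.eq_or_lt with h | h
  · rw [← h]; linarith [hc j]
  refine le_of_forall_pos_le_add fun ε hε => ?_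
  set t := max (τ.startTime b c j) (τ.freeAt b c (j + 1) - ε) with ht
  have htf : t < τ.freeAt b c (j + 1) := max_lt h (by linarith)
  have hst : τ.startTime b c j ≤ t := le_max_left _ _
  have hnot : ¬ c j ≤ service τ.T b 0 t - service τ.T b 0 (τ.startTime b c j) := fun hcon =>
    (csInf_le ⟨τ.startTime b c j, fun t ht => ht.1⟩ ⟨hst, Or.inl hcon⟩ :
      τ.freeAt b c (j + 1) ≤ t).not_gt htf
  have := service_le_add_sub τ.T_pos hb (hs.trans hst) htf.le
  have : τ.freeAt b c (j + 1) - ε ≤ t := le_max_right _ _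
  linarith

/-- The work that remains, at the release of job `j`, for the jobs before it, as far as they
will not be dismissed. -/
noncomputable def backlog (b : ℕ → ℝ → ℝ) (c : ℕ → ℝ) (j : ℕ) : ℝ :=
  service τ.T b 0 (τ.startTime b c j) - service τ.T b 0 (j * τ.T)

theorem backlog_zero : τ.backlog b c 0 = 0 := by simp [backlog, startTime, freeAt]

theorem backlog_succ_le (hb : ∀ j, IsSupply τ.T (b j)) (hc : ∀ j, 0 < c j) (j : ℕ) :
    τ.backlog b c (j + 1) ≤
      max (min (c j + τ.backlog b c j) (service τ.T b j (τ.D + τ.δ)) - b j τ.T) 0 := by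
  have hT := τ.T_pos
  have hD := τ.D_pos
  have hδ := τ.δ_nonneg
  obtain ⟨-, -, -, hfd⟩ := τ.freeAt_le b c j
  have hf0 := (τ.freeAt_le b c (j + 1)).1
  have hfree := τ.service_freeAt_succ_le hb hc j
  have hmul : (0 : ℝ) ≤ j * τ.T := by positivity
  have hdis : service τ.T b 0 (τ.freeAt b c (j + 1)) ≤
      service τ.T b 0 (j * τ.T) + service τ.T b j (τ.D + τ.δ) := by
    rw [← service_mul_add hT hb j (by linarith), ← add_assoc]
    exact service_monotoneOn hT hb hf0 (hf0.trans hfd) hfd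
  have hnext := service_succ_mul hT hb j
  unfold backlog
  -- Either nothing is left at the next release, or job `j` is still present and both the completion
  -- and the dismissal bound on its leaving time apply.
  rcases le_total (τ.freeAt b c (j + 1)) ((j + 1 : ℕ) * τ.T) with h | h
  · rw [startTime, max_eq_left h, sub_self]
    exact le_max_right _ _
  · refine le_max_of_le_left ?_
    rw [startTime, max_eq_right h]
    push_cast
    rw [hnext, le_sub_iff_add_le, le_min_iff]
    constructor <;> linarith

theorem service_lt_of_missesDeadline (hb : ∀ j, IsSupply τ.T (b j)) (hc : ∀ j, 0 < c j) {j : ℕ}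
    (h : τ.MissesDeadline b c j) : service τ.T b j τ.D < c j + τ.backlog b c j := by
  by_contra! hle
  have hT := τ.T_pos
  have hmul : (0 : ℝ) ≤ j * τ.T := by positivity
  have hadd := service_mul_add hT hb j τ.D_pos.le
  have hcj := hc j
  have hs : service τ.T b 0 (τ.startTime b c j) + c j ≤ service τ.T b 0 (j * τ.T + τ.D) := by
    unfold backlog at hle
    linarith
  refine h ⟨j * τ.T + τ.D, ?_, le_rfl, by linarith⟩
  -- A start after the deadline would force `c j ≤ 0` by monotonicity of the service.
  by_contra! hlt
  have := service_monotoneOn hT hb (by linarith [τ.D_pos] : 0 ≤ j * τ.T + τ.D)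
    (τ.startTime_nonneg j) hlt.le
  linarith

end Execution

/-! ### Pathwise comparison with the chain -/

section Coupling

variable (sb : SupplyBounds τ.T)

/-- The states of the chain that is driven by the execution times `c`. -/
noncomputable def statePath (c : ℕ → ℝ) : ℕ → ChainState
  | 0 => τ.jobState sb 0 (c 0)
  | j + 1 => τ.nextState sb (statePath c j) (c (j + 1))

/-- The remaining execution time in the predecessor of the state of job `j`. -/
noncomputable def carryIn (c : ℕ → ℝ) : ℕ → ℝ
  | 0 => 0
  | j + 1 => (τ.statePath sb c j).rem

theorem statePath_eq (c : ℕ → ℝ) (j : ℕ) :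
    τ.statePath sb c j = τ.jobState sb (j % sb.Q) (c j + τ.carryIn sb c j) := by
  induction j with
  | zero => simp [statePath, carryIn]
  | succ j ih =>
    have hslot : (τ.statePath sb c j).slot = j % sb.Q := by rw [ih, jobState]
    rw [statePath, nextState, carryIn, hslot, Nat.mod_add_mod]

/-- A miss state keeps the cap and a hit state drops it, which only increases the value.
Monotonicity of `rem` in `w` is not needed. -/
theorem le_jobState_rem (q : ℕ) {v w : ℝ} (h : v ≤ w) :
    max (min v (service τ.T sb.upper q (τ.D + τ.δ)) - sb.lower q τ.T) 0 ≤
      (τ.jobState sb q w).rem := by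
  simp only [jobState]
  split_ifs
  · gcongr
    exact (min_le_left _ _).trans h
  · gcongr

variable {b : ℕ → ℝ → ℝ} {c : ℕ → ℝ}

theorem backlog_le_carryIn (hb : ∀ j, IsSupply τ.T (b j)) (hbd : sb.Bounds b)
    (hc : ∀ j, 0 < c j) (j : ℕ) : τ.backlog b c j ≤ τ.carryIn sb c j := by
  have hT := τ.T_pos
  induction j with
  | zero => exact τ.backlog_zero.le
  | succ j ih =>
    rw [carryIn, statePath_eq]
    refine (τ.backlog_succ_le hb hc j).trans
      (le_trans ?_ (τ.le_jobState_rem sb (j % sb.Q) (add_le_add le_rfl ih)))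
    have hDδ : 0 ≤ τ.D + τ.δ := add_nonneg τ.D_pos.le τ.δ_nonneg
    have hTmem : τ.T ∈ Set.Icc 0 τ.T := ⟨hT.le, le_rfl⟩
    have hlow : sb.lower (j % sb.Q) τ.T = sb.lower j τ.T :=
      apply_mod_eq sb.lower_periodic j 0 hTmem
    rw [service_mod hT sb.upper_periodic j hDδ, hlow]
    gcongr
    · exact service_le_service hT (fun j t ht => (hbd j t ht).2) j hDδ
    · exact (hbd j _ hTmem).1

theorem statePath_miss_of_missesDeadline (hb : ∀ j, IsSupply τ.T (b j)) (hbd : sb.Bounds b)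
    (hc : ∀ j, 0 < c j) {j : ℕ} (h : τ.MissesDeadline b c j) :
    (τ.statePath sb c j).miss = true := by
  rw [statePath_eq, jobState, decide_eq_true_iff, service_mod τ.T_pos sb.lower_periodic j τ.D_pos.le]
  calc service τ.T sb.lower j τ.D ≤ service τ.T b j τ.D :=
        service_le_service τ.T_pos (fun j t ht => (hbd j t ht).1) j τ.D_pos.le
    _ < c j + τ.backlog b c j := τ.service_lt_of_missesDeadline hb hc h
    _ ≤ _ := by gcongr; exact τ.backlog_le_carryIn sb hb hbd hc j

end Coupling

end PeriodicTask

/-! ### Stationary distributions and the Poisson equation -/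

section StationaryDistribution

open Matrix

variable {S : Type*} [Fintype S] {P : Matrix S S ℝ}

/-- The constant 1 is a left eigenvector, so some `v ≠ 0` has `P v = v`. Then `|v| ≤ P |v|`
entrywise with equal totals, hence equality; normalising `|v|` gives `π`. -/
theorem exists_isStationaryDistribution [Nonempty S] (hP : ∀ r s, 0 ≤ P r s)
    (hsum : ∀ s, ∑ r, P r s = 1) : ∃ π, IsStationaryDistribution P π := by
  classical
  have hdet : (1 - P).det = 0 := Matrix.exists_vecMul_eq_zero_iff.1
    ⟨fun _ => 1, fun h => one_ne_zero (congrFun h (Classical.arbitrary S)), by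
      ext s
      simp [Matrix.vecMul, dotProduct, Matrix.one_apply, hsum]⟩
  obtain ⟨v, hv0, hv⟩ := Matrix.exists_mulVec_eq_zero_iff.2 hdet
  rw [Matrix.sub_mulVec, Matrix.one_mulVec, sub_eq_zero] at hv
  have hle : ∀ r, |v r| ≤ (P *ᵥ fun s => |v s|) r := fun r => by
    conv_lhs => rw [hv]
    refine (Finset.abs_sum_le_sum_abs _ _).trans_eq ?_
    simp only [Matrix.mulVec, dotProduct, abs_mul, abs_of_nonneg (hP _ _)]
  have htot : ∑ r, (P *ᵥ fun s => |v s|) r = ∑ s, |v s| := by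
    simp only [Matrix.mulVec, dotProduct]
    rw [Finset.sum_comm]
    simp [← Finset.sum_mul, hsum]
  have heq : ∀ r, |v r| = (P *ᵥ fun s => |v s|) r := fun r =>
    (Finset.sum_eq_sum_iff_of_le fun r _ => hle r).1 htot.symm r (Finset.mem_univ r)
  have hpos : 0 < ∑ s, |v s| := by
    obtain ⟨s, hs⟩ := Function.ne_iff.1 hv0
    exact Finset.sum_pos' (fun _ _ => abs_nonneg _) ⟨s, Finset.mem_univ s, abs_pos.2 hs⟩
  refine ⟨(∑ s, |v s|)⁻¹ • fun s => |v s|, fun s => ?_, ?_, ?_⟩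
  · exact mul_nonneg (inv_nonneg.2 hpos.le) (abs_nonneg _)
  · simp only [Pi.smul_apply, smul_eq_mul, ← Finset.mul_sum]
    exact inv_mul_cancel₀ hpos.ne'
  · rw [Matrix.mulVec_smul, ← funext heq]

/-- Maximum principle: where `g` is maximal, all successors of positive probability are maximal too,
and irreducibility spreads this to every state. -/
theorem IsIrreducibleChain.eq_of_harmonic (hirr : IsIrreducibleChain P) (hP : ∀ r s, 0 ≤ P r s)
    (hsum : ∀ s, ∑ r, P r s = 1) {g : S → ℝ} (hg : ∀ s, ∑ r, P r s * g r = g s) (r s : S) :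
    g r = g s := by
  obtain ⟨m, -, hm⟩ := Finset.exists_max_image Finset.univ g ⟨r, Finset.mem_univ r⟩
  have hmax : ∀ a, g a ≤ g m := fun a => hm a (Finset.mem_univ a)
  have hstep : ∀ a b, 0 < P b a → g a = g m → g b = g m := fun a b hab ha => by
    have hzero : ∑ r, P r a * (g m - g r) = 0 := by
      simp only [mul_sub, Finset.sum_sub_distrib, ← Finset.sum_mul, hsum, hg, one_mul, ha, sub_self]
    have := (Finset.sum_eq_zero_iff_of_nonneg fun r _ =>
      mul_nonneg (hP r a) (sub_nonneg.2 (hmax r))).1 hzero b (Finset.mem_univ b)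
    rcases mul_eq_zero.1 this with h | h
    · exact absurd h hab.ne'
    · linarith
  have hall : ∀ a, g a = g m := fun a => by
    have h := hirr m a
    induction h with
    | single h => exact hstep _ _ h rfl
    | tail _ h ih => exact hstep _ _ h ih
  rw [hall r, hall s]

theorem IsStationaryDistribution.sum_mul_sum {π : S → ℝ} (hπ : IsStationaryDistribution P π)
    (g : S → ℝ) : ∑ s, π s * ∑ r, P r s * g r = ∑ r, π r * g r := by
  conv_rhs => rw [← hπ.invariant]
  simp only [Matrix.mulVec, dotProduct, Finset.mul_sum, Finset.sum_mul]
  rw [Finset.sum_comm]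
  exact Finset.sum_congr rfl fun _ _ => Finset.sum_congr rfl fun _ _ => by ring

/-- Solvability of the Poisson equation of an irreducible finite chain. -/
theorem IsIrreducibleChain.exists_poisson (hirr : IsIrreducibleChain P) (hP : ∀ r s, 0 ≤ P r s)
    (hsum : ∀ s, ∑ r, P r s = 1) {π : S → ℝ} (hπ : IsStationaryDistribution P π) (f : S → ℝ) :
    ∃ g : S → ℝ, ∀ s, f s = g s - ∑ r, P r s * g r + ∑ r, π r * f r := by
  -- The added mean removes the constants from the kernel, so `L` is injective, hence surjective;
  -- `hπL` turns the mean of `g` into that of `f`.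
  let L : (S → ℝ) →ₗ[ℝ] (S → ℝ) :=
    { toFun := fun g s => g s - ∑ r, P r s * g r + ∑ r, π r * g r
      map_add' := fun g g' => by
        ext s
        simp only [Pi.add_apply, mul_add, Finset.sum_add_distrib]
        ring
      map_smul' := fun a g => by
        ext s
        simp only [Pi.smul_apply, smul_eq_mul, RingHom.id_apply, mul_left_comm _ a,
          ← Finset.mul_sum]
        ring }
  have hπL : ∀ g, ∑ s, π s * L g s = ∑ s, π s * g s := fun g => by
    simp only [L, LinearMap.coe_mk, AddHom.coe_mk, mul_add, mul_sub, Finset.sum_add_distrib,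
      Finset.sum_sub_distrib, hπ.sum_mul_sum, ← Finset.sum_mul, hπ.sum_eq_one]
    ring
  have hinj : Function.Injective L := (injective_iff_map_eq_zero L).2 fun g hg => by
    have h0 : ∑ s, π s * g s = 0 := by rw [← hπL, hg]; simp
    have hharm : ∀ s, ∑ r, P r s * g r = g s := fun s => by
      have := congrFun hg s
      simp only [L, LinearMap.coe_mk, AddHom.coe_mk, h0, Pi.zero_apply] at this
      linarith
    ext s
    rw [Finset.sum_congr rfl fun r _ => by
      rw [hirr.eq_of_harmonic hP hsum hharm r s], ← Finset.sum_mul, hπ.sum_eq_one, one_mul] at h0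
    exact h0
  obtain ⟨g, hg⟩ := LinearMap.injective_iff_surjective.1 hinj f
  refine ⟨g, fun s => ?_⟩
  rw [← hg, hπL]
  rfl

/-- Averaging the Poisson equation for the indicator of `s` against `π'` leaves only the constant `π
s`. -/
theorem IsIrreducibleChain.stationary_unique (hirr : IsIrreducibleChain P)
    (hP : ∀ r s, 0 ≤ P r s) (hsum : ∀ s, ∑ r, P r s = 1) {π π' : S → ℝ}
    (hπ : IsStationaryDistribution P π) (hπ' : IsStationaryDistribution P π') : π' = π := by
  classical
  ext s
  obtain ⟨g, hg⟩ := hirr.exists_poisson hP hsum hπ (Pi.single s 1)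
  have h : ∑ r, π' r * Pi.single (M := fun _ => ℝ) s 1 r =
      ∑ r, π r * Pi.single (M := fun _ => ℝ) s 1 r := by
    rw [Finset.sum_congr rfl fun r _ => by rw [hg r]]
    simp only [mul_add, mul_sub, Finset.sum_add_distrib, Finset.sum_sub_distrib,
      hπ'.sum_mul_sum, ← Finset.sum_mul, hπ'.sum_eq_one]
    ring
  simpa [Pi.single_apply] using h

end StationaryDistribution

/-! ### Functions of finitely many independent inputs -/

theorem DependsOn.exists_comp_restrict {ι : Type*} {n : ℕ} {A : (ℕ → ι) → ℝ} (hA : DependsOn A (Set.Iic n)) :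
    ∃ F : (Finset.range (n + 1) → ι) → ℝ, ∀ k, A k = F fun i => k i := by
  -- Later coordinates are irrelevant; filling them with coordinate 0 avoids assuming `ι` nonempty.
  refine ⟨fun x => A fun i => if h : i ∈ Finset.range (n + 1) then x ⟨i, h⟩ else
    x ⟨0, by simp⟩, fun k => hA fun i hi => ?_⟩
  have : i ∈ Finset.range (n + 1) := Finset.mem_range_succ_iff.2 hi
  simp [this]

section AdaptedFunctions

variable {ι : Type*} [Finite ι] [MeasurableSpace ι] [MeasurableSingletonClass ι]
  {Ω : Type*} [MeasurableSpace Ω] {μ : Measure Ω} {K : ℕ → Ω → ι}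

theorem DependsOn.integrable_comp [IsFiniteMeasure μ] (hK : ∀ j, Measurable (K j)) {n : ℕ}
    {A : (ℕ → ι) → ℝ} (hA : DependsOn A (Set.Iic n)) :
    Integrable (fun ω => A fun j => K j ω) μ := by
  obtain ⟨F, hF⟩ := hA.exists_comp_restrict
  simp only [hF]
  have hm : Measurable fun ω => fun i : Finset.range (n + 1) => K i ω :=
    measurable_pi_lambda _ fun i => hK i
  exact (Integrable.of_finite (μ := μ.map _) (f := F)).comp_measurable hm

theorem DependsOn.integral_mul_next (hK : ∀ j, Measurable (K j)) (hind : iIndepFun K μ) {n : ℕ}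
    {A : (ℕ → ι) → ℝ} (hA : DependsOn A (Set.Iic n)) (H : ι → ℝ) :
    ∫ ω, A (fun j => K j ω) * H (K (n + 1) ω) ∂μ =
      (∫ ω, A (fun j => K j ω) ∂μ) * ∫ ω, H (K (n + 1) ω) ∂μ := by
  obtain ⟨F, hF⟩ := hA.exists_comp_restrict
  simp only [hF]
  have hm : Measurable fun ω => fun i : Finset.range (n + 1) => K i ω :=
    measurable_pi_lambda _ fun i => hK i
  have hFm : Measurable F := measurable_of_finite F
  have hHm : Measurable H := measurable_of_finite H
  have h1 := (hind.indepFun_finset (Finset.range (n + 1)) {n + 1} (by simp) hK).comp hFm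
    (hHm.comp (measurable_pi_apply (⟨n + 1, by simp⟩ : ({n + 1} : Finset ℕ))))
  exact h1.integral_fun_mul_eq_mul_integral (hFm.comp hm).aestronglyMeasurable
    (hHm.comp (hK (n + 1))).aestronglyMeasurable

end AdaptedFunctions

theorem sum_mul_exp_le {ι : Type*} [Fintype ι] {p : ι → ℝ} (hp0 : ∀ k, 0 ≤ p k) (hp1 : ∑ k, p k = 1) {x : ι → ℝ}
    (hx : ∑ k, p k * x k = 0) {a : ℝ} (ha : a ≤ 1) (hxa : ∀ k, |x k| ≤ a) :
    ∑ k, p k * Real.exp (x k) ≤ Real.exp (a ^ 2) := by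
  calc ∑ k, p k * Real.exp (x k) ≤ ∑ k, p k * (1 + x k + a ^ 2) := by
        gcongr with k
        · exact hp0 k
        · have h1 := (abs_le.1 (Real.abs_exp_sub_one_sub_id_le ((hxa k).trans ha))).2
          have h2 := sq_le_sq' (abs_le.1 (hxa k)).1 (abs_le.1 (hxa k)).2
          linarith
    _ = 1 + a ^ 2 := by
        simp only [mul_add, Finset.sum_add_distrib, hx, ← Finset.sum_mul, hp1]
        ring
    _ ≤ _ := by linarith [Real.add_one_le_exp (a ^ 2)]

/-! ### Exponential tail bounds and the ergodic upper bound -/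

section RandomIteration

variable {S ι : Type*}

/-- The iteration of the maps `F · x` along the inputs `k`. -/
def orbit (init : ι → S) (F : S → ι → S) (k : ℕ → ι) : ℕ → S
  | 0 => init (k 0)
  | n + 1 => F (orbit init F k n) (k (n + 1))

theorem dependsOn_orbit (init : ι → S) (F : S → ι → S) (n : ℕ) :
    DependsOn (fun k => orbit init F k n) (Set.Iic n) := by
  induction n with
  | zero => exact fun x y h => by simp only [orbit, h 0 (Set.mem_Iic.2 le_rfl)]
  | succ n ih =>
    intro x y h
    have := ih fun i hi => h i (Set.mem_Iic.2 (Nat.le_succ_of_le hi))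
    simp only at this
    simp only [orbit, this, h (n + 1) (Set.mem_Iic.2 le_rfl)]

/-- The sum of the first `n` increments `G` along an orbit. -/
def orbitSum (init : ι → S) (F : S → ι → S) (G : S → ι → ℝ) (n : ℕ) (k : ℕ → ι) : ℝ :=
  ∑ j ∈ Finset.range n, G (orbit init F k j) (k (j + 1))

theorem dependsOn_orbitSum (init : ι → S) (F : S → ι → S) (G : S → ι → ℝ) (n : ℕ) :
    DependsOn (orbitSum init F G n) (Set.Iic n) := by
  intro x y h
  refine Finset.sum_congr rfl fun j hj => ?_
  have hj' : j + 1 ≤ n := Finset.mem_range.1 hj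
  have := dependsOn_orbit init F j fun i hi =>
    h i (Set.mem_Iic.2 ((Set.mem_Iic.1 hi).trans (j.le_succ.trans hj')))
  simp only at this
  rw [this, h (j + 1) (Set.mem_Iic.2 hj')]

variable [Fintype S] [Fintype ι] [MeasurableSpace ι] [MeasurableSingletonClass ι]
  {Ω : Type*} [MeasurableSpace Ω] {μ : Measure Ω} [IsProbabilityMeasure μ] {K : ℕ → Ω → ι}
  {init : ι → S} {F : S → ι → S} {G : S → ι → ℝ} {p : ι → ℝ}

theorem integral_comp_eq_sum (hK : ∀ j, Measurable (K j))
    (hp : ∀ j k, μ.real {ω | K j ω = k} = p k) (H : ι → ℝ) (j : ℕ) :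
    ∫ ω, H (K j ω) ∂μ = ∑ k, p k * H k := by
  rw [← integral_map (hK j).aemeasurable (measurable_of_finite H).aestronglyMeasurable,
    integral_fintype Integrable.of_finite]
  refine Finset.sum_congr rfl fun k _ => ?_
  rw [← hp j k, smul_eq_mul, map_measureReal_apply (hK j) (measurableSet_singleton k)]
  rfl

/-- Splitting by the current state `s` replaces conditional expectations: each `A s` depends on
inputs up to `n` and is independent of input `n + 1`. -/
theorem integral_exp_orbitSum_le (hK : ∀ j, Measurable (K j)) (hind : iIndepFun K μ)
    (hp0 : ∀ k, 0 ≤ p k) (hp1 : ∑ k, p k = 1) (hp : ∀ j k, μ.real {ω | K j ω = k} = p k)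
    (hG : ∀ s, ∑ k, p k * G s k = 0) {B θ : ℝ} (hB : ∀ s k, |G s k| ≤ B) (hθ : 0 ≤ θ)
    (hθB : θ * B ≤ 1) (n : ℕ) :
    ∫ ω, Real.exp (θ * orbitSum init F G n fun j => K j ω) ∂μ ≤
      Real.exp ((θ * B) ^ 2) ^ n := by
  classical
  induction n with
  | zero => simp [orbitSum]
  | succ n ih =>
    let A : S → (ℕ → ι) → ℝ := fun s k =>
      if orbit init F k n = s then Real.exp (θ * orbitSum init F G n k) else 0
    have hA : ∀ s, DependsOn (A s) (Set.Iic n) := fun s x y h => by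
      have := dependsOn_orbit init F n h
      simp only at this
      simp only [A, this, dependsOn_orbitSum init F G n h]
    have hA0 : ∀ s k, 0 ≤ A s k := fun s k => by
      simp only [A]
      split_ifs <;> positivity
    have hsumA : ∀ k, ∑ s, A s k = Real.exp (θ * orbitSum init F G n k) := fun k => by simp [A]
    have hsplit : ∀ k : ℕ → ι, Real.exp (θ * orbitSum init F G (n + 1) k) =
        ∑ s, A s k * Real.exp (θ * G s (k (n + 1))) := fun k => by
      simp [A, orbitSum, Finset.sum_range_succ, mul_add, Real.exp_add]
    have hint : ∀ s, Integrable
        (fun ω => A s (fun j => K j ω) * Real.exp (θ * G s (K (n + 1) ω))) μ := fun s =>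
      DependsOn.integrable_comp hK (n := n + 1)
        (A := fun k => A s k * Real.exp (θ * G s (k (n + 1)))) fun x y h => by
          simp only [hA s fun i hi => h i (Set.mem_Iic.2 (Nat.le_succ_of_le hi)),
            h (n + 1) (Set.mem_Iic.2 le_rfl)]
    calc ∫ ω, Real.exp (θ * orbitSum init F G (n + 1) fun j => K j ω) ∂μ
        = ∑ s, (∫ ω, A s (fun j => K j ω) ∂μ) * ∑ k, p k * Real.exp (θ * G s k) := by
          simp only [hsplit]
          rw [integral_finsetSum _ fun s _ => hint s]
          refine Finset.sum_congr rfl fun s _ => ?_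
          rw [(hA s).integral_mul_next hK hind fun k => Real.exp (θ * G s k),
            integral_comp_eq_sum hK hp fun k => Real.exp (θ * G s k)]
      _ ≤ ∑ s, (∫ ω, A s (fun j => K j ω) ∂μ) * Real.exp ((θ * B) ^ 2) := by
          refine Finset.sum_le_sum fun s _ => mul_le_mul_of_nonneg_left ?_
            (integral_nonneg fun ω => hA0 s _)
          refine sum_mul_exp_le hp0 hp1 ?_ hθB fun k => ?_
          · simp only [mul_left_comm _ θ, ← Finset.mul_sum, hG, mul_zero]
          · rw [abs_mul, abs_of_nonneg hθ]
            exact mul_le_mul_of_nonneg_left (hB s k) hθ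
      _ = (∫ ω, Real.exp (θ * orbitSum init F G n fun j => K j ω) ∂μ) *
            Real.exp ((θ * B) ^ 2) := by
          rw [← Finset.sum_mul, ← integral_finsetSum _ fun s _ => (hA s).integrable_comp hK]
          simp only [hsumA]
      _ ≤ _ := by
          rw [pow_succ]
          exact mul_le_mul_of_nonneg_right ih (Real.exp_nonneg _)

theorem ae_eventually_orbitSum_lt (hK : ∀ j, Measurable (K j)) (hind : iIndepFun K μ)
    (hp0 : ∀ k, 0 ≤ p k) (hp1 : ∑ k, p k = 1) (hp : ∀ j k, μ.real {ω | K j ω = k} = p k)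
    (hG : ∀ s, ∑ k, p k * G s k = 0) {ε : ℝ} (hε : 0 < ε) :
    ∀ᵐ ω ∂μ, ∀ᶠ n : ℕ in atTop, orbitSum init F G n (fun j => K j ω) < ε * n := by
  -- Taking `B ≥ ε` ensures `θ * B ≤ 1` below.
  obtain ⟨B, hεB, hB⟩ : ∃ B, ε ≤ B ∧ ∀ s k, |G s k| ≤ B := by
    obtain ⟨B, hB⟩ := (Set.finite_range fun x : S × ι => |G x.1 x.2|).bddAbove
    exact ⟨max ε B, le_max_left _ _, fun s k => (hB ⟨(s, k), rfl⟩).trans (le_max_right _ _)⟩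
  have hBpos : 0 < B := hε.trans_le hεB
  -- This minimises the Chernoff exponent `-θ ε + θ² B²`.
  set θ := ε / (2 * B ^ 2) with hθdef
  have hθ : 0 < θ := by positivity
  have hθB : θ * B = ε / (2 * B) := by rw [hθdef]; field_simp
  have hθB1 : θ * B ≤ 1 := by
    rw [hθB, div_le_one (by positivity)]
    linarith
  have hsq : (θ * B) ^ 2 = θ * ε / 2 := by rw [hθdef]; field_simp
  set r := Real.exp (-(θ * ε / 2)) with hr
  have hr1 : r < 1 := Real.exp_lt_one_iff.2 (by linarith [mul_pos hθ hε])
  have htail : ∀ n : ℕ,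
      μ.real {ω | ε * n ≤ orbitSum init F G n fun j => K j ω} ≤ r ^ n := fun n => by
    have hint : Integrable (fun ω => Real.exp (θ * orbitSum init F G n fun j => K j ω)) μ :=
      DependsOn.integrable_comp hK (n := n)
        (A := fun k => Real.exp (θ * orbitSum init F G n k)) fun x y h => by
          simp only [dependsOn_orbitSum init F G n h]
    calc _ ≤ Real.exp (-θ * (ε * n)) * Real.exp ((θ * B) ^ 2) ^ n :=
          (measure_ge_le_exp_mul_mgf _ hθ.le hint).trans (mul_le_mul_of_nonneg_left
            (integral_exp_orbitSum_le hK hind hp0 hp1 hp hG hB hθ.le hθB1 n) (Real.exp_nonneg _))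
      _ = r ^ n := by
          rw [hsq, hr, ← Real.exp_nat_mul, ← Real.exp_nat_mul, ← Real.exp_add]
          congr 1
          ring
  have hsum : ∑' n : ℕ, μ {ω | ε * n ≤ orbitSum init F G n fun j => K j ω} ≠ ⊤ := by
    have hgeo : Summable fun n : ℕ => r ^ n :=
      summable_geometric_of_lt_one (Real.exp_nonneg _) hr1
    refine ne_top_of_le_ne_top hgeo.tsum_ofReal_ne_top (ENNReal.tsum_le_tsum fun n => ?_)
    rw [← ofReal_measureReal]
    exact ENNReal.ofReal_le_ofReal (htail n)
  filter_upwards [ae_eventually_notMem hsum] with ω hω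
  exact hω.mono fun n hn => not_le.1 hn

/-- Upper half of the ergodic theorem for a finite irreducible chain that is driven by
independent inputs. -/
theorem ae_eventually_sum_orbit_lt {P : Matrix S S ℝ} (hirr : IsIrreducibleChain P)
    (hP : ∀ r s, 0 ≤ P r s) (hcol : ∀ s, ∑ r, P r s = 1)
    (hPF : ∀ (g : S → ℝ) (s : S), ∑ r, P r s * g r = ∑ k, p k * g (F s k))
    {π : S → ℝ} (hπ : IsStationaryDistribution P π) (hK : ∀ j, Measurable (K j))
    (hind : iIndepFun K μ) (hp0 : ∀ k, 0 ≤ p k) (hp1 : ∑ k, p k = 1)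
    (hp : ∀ j k, μ.real {ω | K j ω = k} = p k) (f : S → ℝ) {ε : ℝ} (hε : 0 < ε) :
    ∀ᵐ ω ∂μ, ∀ᶠ n : ℕ in atTop,
      ∑ j ∈ Finset.range n, f (orbit init F (fun j => K j ω) j) < (∑ s, π s * f s + ε) * n := by
  obtain ⟨g, hg⟩ := hirr.exists_poisson hP hcol hπ f
  obtain ⟨B, hB⟩ := (Set.finite_range fun s => |g s|).bddAbove
  replace hB : ∀ s, |g s| ≤ B := fun s => hB ⟨s, rfl⟩
  have hG : ∀ s, ∑ k, p k * (g (F s k) - ∑ r, P r s * g r) = 0 := fun s => by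
    simp only [mul_sub, Finset.sum_sub_distrib, ← Finset.sum_mul, hp1, ← hPF, one_mul, sub_self]
  filter_upwards [ae_eventually_orbitSum_lt (init := init) (F := F) hK hind hp0 hp1 hp hG
    (half_pos hε)] with ω hω
  -- Beyond this threshold the telescoped term, at most `2 * B`, costs no more than the other half
  -- of `ε * n`.
  filter_upwards [hω, tendsto_natCast_atTop_atTop.eventually_ge_atTop (2 * B / (ε / 2))]
    with n hn hnB
  set x := orbit init F fun j => K j ω with hx
  have hsum : ∑ j ∈ Finset.range n, f (x j) = g (x 0) - g (x n) +
      orbitSum init F (fun s k => g (F s k) - ∑ r, P r s * g r) n (fun j => K j ω) +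
        (∑ s, π s * f s) * n := by
    have hstep : ∀ j, f (x j) = (g (x j) - g (x (j + 1))) +
        (g (F (x j) (K (j + 1) ω)) - ∑ r, P r (x j) * g r) + ∑ s, π s * f s := fun j => by
      have : x (j + 1) = F (x j) (K (j + 1) ω) := rfl
      rw [this, hg (x j)]
      ring
    rw [Finset.sum_congr rfl fun j _ => hstep j, Finset.sum_add_distrib, Finset.sum_add_distrib,
      Finset.sum_range_sub', Finset.sum_const, Finset.card_range, nsmul_eq_mul, mul_comm (n : ℝ)]
    rfl
  rw [hsum]
  have h1 := (abs_le.1 (hB (x 0))).2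
  have h2 := (abs_le.1 (hB (x n))).1
  have h3 := (div_le_iff₀ (half_pos hε)).1 hnB
  linarith

end RandomIteration

/-! ### The task chain as a random iteration, and its miss rate -/

namespace PeriodicTask

variable (τ : PeriodicTask)

theorem nonempty_index : Nonempty (Fin τ.h) := by
  by_contra h
  rw [not_nonempty_iff] at h
  simpa using τ.p_sum

theorem measurableEmbedding_e : MeasurableEmbedding τ.e where
  injective := τ.e_strictMono.injective
  measurable := measurable_of_finite _
  measurableSet_image' := fun _ _ => ((Set.toFinite _).image _).measurableSet

section Chain

variable (sb : SupplyBounds τ.T)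

/-- The state of the first job. -/
noncomputable def initialState (k : Fin τ.h) : τ.ChainSpace sb := ⟨_, Reachable.init k⟩

/-- The successor within the state space. -/
noncomputable def successor (s : τ.ChainSpace sb) (k : Fin τ.h) : τ.ChainSpace sb :=
  ⟨_, Reachable.step s.1 k s.2⟩

theorem orbit_val (k : ℕ → Fin τ.h) (n : ℕ) :
    (orbit (τ.initialState sb) (τ.successor sb) k n).1 = τ.statePath sb (fun j => τ.e (k j)) n := by
  induction n with
  | zero => rfl
  | succ n ih => simp only [orbit, successor, statePath, ih]

theorem transition_nonneg (r s : τ.ChainSpace sb) : 0 ≤ τ.transition sb r s :=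
  Finset.sum_nonneg fun k _ => by
    split_ifs
    exacts [τ.p_nonneg k, le_rfl]

variable [Fintype (τ.ChainSpace sb)]

theorem sum_transition_mul (g : τ.ChainSpace sb → ℝ) (s : τ.ChainSpace sb) :
    ∑ r, τ.transition sb r s * g r = ∑ k, τ.p k * g (τ.successor sb s k) := by
  classical
  simp only [transition, Finset.sum_mul]
  rw [Finset.sum_comm]
  refine Finset.sum_congr rfl fun k _ => ?_
  rw [Finset.sum_eq_single (τ.successor sb s k)]
  · exact congrArg (· * _) (if_pos rfl)
  · intro r _ hr
    rw [if_neg fun h => hr (Subtype.ext h.symm), zero_mul]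
  · simp

theorem sum_transition (s : τ.ChainSpace sb) : ∑ r, τ.transition sb r s = 1 := by
  simpa [τ.p_sum] using τ.sum_transition_mul sb (fun _ => 1) s

end Chain

section ExecutionTime

variable {τ} {Ω : Type*} [MeasurableSpace Ω] {μ : Measure Ω} [IsProbabilityMeasure μ]
  {C : ℕ → Ω → ℝ}

theorem IsExecutionTime.ae_mem_range (hC : τ.IsExecutionTime μ C) (j : ℕ) :
    ∀ᵐ ω ∂μ, C j ω ∈ Set.range τ.e := by
  have hms : ∀ k, MeasurableSet {ω | C j ω = τ.e k} := fun k =>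
    hC.measurable j (measurableSet_singleton (τ.e k))
  have h : μ.real (⋃ k, {ω | C j ω = τ.e k}) = 1 := by
    rw [measureReal_iUnion_fintype (fun k l hkl => Set.disjoint_left.2 fun ω hk hl =>
      hkl (τ.e_strictMono.injective (hk.symm.trans hl))) hms]
    simp only [hC.law, τ.p_sum]
  have h1 : μ (⋃ k, {ω | C j ω = τ.e k}) = 1 := by
    rw [← ofReal_measureReal, h, ENNReal.ofReal_one]
  filter_upwards [(mem_ae_iff_prob_eq_one (MeasurableSet.iUnion hms)).2 h1] with ω hω
  obtain ⟨k, hk⟩ := Set.mem_iUnion.1 hω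
  exact ⟨k, Eq.symm hk⟩

theorem IsExecutionTime.exists_index (hC : τ.IsExecutionTime μ C) :
    ∃ K : ℕ → Ω → Fin τ.h, (∀ j, Measurable (K j)) ∧ iIndepFun K μ ∧
      (∀ j k, μ.real {ω | K j ω = k} = τ.p k) ∧ ∀ᵐ ω ∂μ, ∀ j, C j ω = τ.e (K j ω) := by
  have := τ.nonempty_index
  -- A measurable left inverse of `τ.e`; its default value matters only on a null set.
  let φ : ℝ → Fin τ.h := Function.extend τ.e id fun _ => Classical.arbitrary _
  have hφe : ∀ k, φ (τ.e k) = k := fun k => τ.e_strictMono.injective.extend_apply _ _ k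
  have hφ : Measurable φ := τ.measurableEmbedding_e.measurable_extend measurable_id measurable_const
  have hae : ∀ j, ∀ᵐ ω ∂μ, C j ω = τ.e (φ (C j ω)) := fun j => by
    filter_upwards [hC.ae_mem_range j] with ω hω
    obtain ⟨k, hk⟩ := hω
    rw [← hk, hφe]
  refine ⟨fun j => φ ∘ C j, fun j => hφ.comp (hC.measurable j),
    hC.indep.comp (fun _ => φ) fun _ => hφ, fun j k => ?_, ae_all_iff.2 hae⟩
  rw [← hC.law j k]
  refine measureReal_congr ?_
  filter_upwards [hae j] with ω hω
  refine propext ⟨fun h => ?_, fun h => ?_⟩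
  · change φ (C j ω) = k at h
    change C j ω = τ.e k
    rw [hω, h]
  · change C j ω = τ.e k at h
    change φ (C j ω) = k
    rw [h, hφe]

end ExecutionTime

section MissRate

variable {τ}

theorem missRate_nonneg (b : ℕ → ℝ → ℝ) (c : ℕ → ℝ) (N : ℕ) : 0 ≤ τ.missRate b c N :=
  mul_nonneg (by positivity) (Finset.sum_nonneg fun j _ => by split_ifs <;> norm_num)

theorem missRate_le_of_sum_miss_lt {sb : SupplyBounds τ.T} {b : ℕ → ℝ → ℝ} {c : ℕ → ℝ}
    (hb : ∀ j, IsSupply τ.T (b j)) (hbd : sb.Bounds b) (hc : ∀ j, 0 < c j) {N : ℕ} {a : ℝ}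
    (h : ∑ j ∈ Finset.range N, (if (τ.statePath sb c j).miss = true then (1 : ℝ) else 0) < a * N) :
    τ.missRate b c N ≤ a := by
  -- The strict inequality in `h` excludes `N = 0`.
  have hN : (0 : ℝ) < N := Nat.cast_pos.2 <| Nat.pos_of_ne_zero fun h0 => by simp [h0] at h
  rw [missRate, one_div, inv_mul_le_iff₀ hN, mul_comm (N : ℝ)]
  refine le_trans (Finset.sum_le_sum fun j _ => ?_) h.le
  by_cases hm : τ.MissesDeadline b c j
  · rw [if_pos hm, if_pos (τ.statePath_miss_of_missesDeadline sb hb hbd hc hm)]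
  · rw [if_neg hm]
    split_ifs <;> norm_num

variable {sb : SupplyBounds τ.T} [Fintype (τ.ChainSpace sb)]
  {Ω : Type*} [MeasurableSpace Ω] {μ : Measure Ω} [IsProbabilityMeasure μ] {C : ℕ → Ω → ℝ}
  {β : Ω → ℕ → ℝ → ℝ} {π : τ.ChainSpace sb → ℝ}

theorem ae_limsup_missRate_le (hirr : IsIrreducibleChain (τ.transition sb))
    (hπ : IsStationaryDistribution (τ.transition sb) π) (hC : τ.IsExecutionTime μ C)
    (hβ : ∀ ω j, IsSupply τ.T (β ω j)) (hbd : ∀ ω, sb.Bounds (β ω)) :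
    ∀ᵐ ω ∂μ, limsup (fun N : ℕ => τ.missRate (β ω) (fun j => C j ω) N) atTop
      ≤ ∑ s ∈ τ.missStates sb, π s := by
  obtain ⟨K, hK, hind, hlaw, hCK⟩ := hC.exists_index
  have hf : ∑ s, π s * (if s.1.miss = true then (1 : ℝ) else 0) = ∑ s ∈ τ.missStates sb, π s := by
    simp [missStates, Finset.sum_filter]
  -- Countably many tolerances, so that one null set serves them all.
  have key : ∀ m : ℕ, ∀ᵐ ω ∂μ, ∀ᶠ N : ℕ in atTop,
      ∑ j ∈ Finset.range N, (if (orbit (τ.initialState sb) (τ.successor sb)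
        (fun j => K j ω) j).1.miss = true then (1 : ℝ) else 0) <
        (∑ s ∈ τ.missStates sb, π s + 1 / ((m : ℝ) + 1)) * N := fun m => by
    rw [← hf]
    exact ae_eventually_sum_orbit_lt hirr (τ.transition_nonneg sb) (τ.sum_transition sb)
      (τ.sum_transition_mul sb) hπ hK hind τ.p_nonneg τ.p_sum hlaw
      (fun s => if s.1.miss = true then (1 : ℝ) else 0) Nat.one_div_pos_of_nat
  filter_upwards [ae_all_iff.2 key, hCK] with ω hω hCω
  have hc : (fun j => C j ω) = fun j => τ.e (K j ω) := funext hCω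
  refine le_of_forall_pos_le_add fun ε hε => ?_
  obtain ⟨m, hm⟩ := exists_nat_one_div_lt hε
  refine le_trans (limsup_le_of_le
    (isCoboundedUnder_le_of_le atTop fun N => missRate_nonneg _ _ N) ?_)
    (add_le_add le_rfl hm.le)
  filter_upwards [hω m] with N hN
  simp only [orbit_val] at hN
  rw [hc]
  exact missRate_le_of_sum_miss_lt (hβ ω) (hbd ω) (fun j => τ.e_pos _) hN

end MissRate

end PeriodicTask

theorem theorem4 (τ : PeriodicTask) (sb : SupplyBounds τ.T)
    [Fintype (τ.ChainSpace sb)]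
    (hirr : IsIrreducibleChain (τ.transition sb)) :
    ∃ π : τ.ChainSpace sb → ℝ,
      IsStationaryDistribution (τ.transition sb) π ∧
      (∀ π' : τ.ChainSpace sb → ℝ, IsStationaryDistribution (τ.transition sb) π' → π' = π) ∧
      ∀ {Ω : Type*} [MeasurableSpace Ω] (μ : Measure Ω) [IsProbabilityMeasure μ]
        (C : ℕ → Ω → ℝ) (_ : τ.IsExecutionTime μ C)
        (β : Ω → ℕ → ℝ → ℝ) (_ : ∀ ω j, IsSupply τ.T (β ω j))
        (_ : ∀ ω, sb.Bounds (β ω)),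
        (∀ᵐ ω ∂μ, limsup (fun N : ℕ => τ.missRate (β ω) (fun j => C j ω) N) atTop
          ≤ ∑ s ∈ τ.missStates sb, π s) ∧
        (∀ DMR : ℝ,
          (∀ᵐ ω ∂μ, Tendsto (fun N : ℕ => τ.missRate (β ω) (fun j => C j ω) N) atTop (𝓝 DMR)) →
          DMR ≤ ∑ s ∈ τ.missStates sb, π s) := by
  have hP := τ.transition_nonneg sb
  have hsum := τ.sum_transition sb
  have : Nonempty (τ.ChainSpace sb) := τ.nonempty_index.map (τ.initialState sb)
  obtain ⟨π, hπ⟩ := exists_isStationaryDistribution hP hsum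
  refine ⟨π, hπ, fun π' hπ' => hirr.stationary_unique hP hsum hπ hπ', ?_⟩
  intro Ω _ μ _ C hC β hβ hbd
  have hlim := PeriodicTask.ae_limsup_missRate_le hirr hπ hC hβ hbd
  refine ⟨hlim, fun DMR hDMR => ?_⟩
  -- Both sides are constants, so a single outcome suffices.
  obtain ⟨ω, hω, hω'⟩ := (hlim.and hDMR).exists
  rwa [hω'.limsup_eq] at hω
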